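/- Let $S$ be a scheme and let $\mathrm{Sch}/S$ be the category of schemes over $S$. Call a morphism of schemes $f\colon X\to Y$ \emph{fpqc} if it is faithfully flat (flat and surjective) and every quasi-compact open subset of $Y$ is the image of a quasi-compact open subset of $X$. Consider the following (pre)topologies on $\mathrm{Sch}/S$, given by their coverings, which are (small) families $\{U_i\to U\}$ of morphisms of $S$-schemes: \begin{itemize} \item \emph{fpqc}: the induced morphism $\coprod_i U_i\to U$ is fpqc; \item \emph{fppf}: the family is jointly surjective and each $U_i\to U$ is flat and locally of finite presentation; \item \emph{étale}: the family is jointly surjective and each $U_i\to U$ is étale (in particular locally of finite presentation). \end{itemize} A topology is \emph{subcanonical} if every representable functor is a sheaf for it. \textbf{Theorem (Grothendieck).} \begin{enumerate} \item Every representable functor $(\mathrm{Sch}/S)^{\mathrm{op}}\to\mathrm{Set}$ is a sheaf for the fpqc topology. \item Every morphism $f\colon V\to U$ of $S$-schemes that is fpqc is an effective epimorphism in $\mathrm{Sch}/S$: for every $S$-scheme $X$, each $S$-morphism $b\colon V\to X$ with $b\circ\mathrm{pr}_1=b\circ\mathrm{pr}_2$ on $V\times_U V$ factors uniquely as $b=a\circ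 f$ with an $S$-morphism $a\colon U\to X$. \item The fpqc topology on $\mathrm{Sch}/S$ is subcanonical, and so are the étale and the fppf topologies. \end{enumerate} -/

import Mathlib

open CategoryTheory Limits AlgebraicGeometry Opposite

universe u

namespace FpqcDescent

/-- An fpqc morphism: faithfully flat (i.e. flat and surjective), and such that every quasi-compact
open subset of the target is the image of a quasi-compact open subset of the source. -/
structure IsFpqc {X Y : Scheme.{u}} (f : X ⟶ Y) : Prop where
  flat : Flat f
  surjective : Surjective f
  exists_isCompact : ∀ V : Y.Opens, IsCompact (V : Set Y) →
    ∃ U : X.Opens, IsCompact (U : Set X) ∧ f '' (U : Set X) = V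

/-- A small family `{Xᵢ ⟶ U}` is an fpqc covering if the induced morphism `∐ Xᵢ ⟶ U` is fpqc. -/
def IsFpqcCovering {U : Scheme.{u}} {ι : Type u} {X : ι → Scheme.{u}} (f : ∀ i, X i ⟶ U) : Prop :=
  IsFpqc (Sigma.desc f)

/-- Flat morphisms of schemes. -/
def flatProp : MorphismProperty Scheme.{u} := fun _ _ f ↦ Flat f

/-- Flat morphisms of schemes that are locally of finite presentation. -/
def fppfProp : MorphismProperty Scheme.{u} := fun _ _ f ↦ Flat f ∧ LocallyOfFinitePresentation f

/-- Étale morphisms of schemes (these are locally of finite presentation). -/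
def etaleProp : MorphismProperty Scheme.{u} := fun _ _ f ↦ Etale f

instance : flatProp.{u}.IsMultiplicative :=
  inferInstanceAs (MorphismProperty.IsMultiplicative (@Flat.{u} : MorphismProperty Scheme.{u}))

instance : flatProp.{u}.IsStableUnderBaseChange :=
  inferInstanceAs
    (MorphismProperty.IsStableUnderBaseChange (@Flat.{u} : MorphismProperty Scheme.{u}))

instance : etaleProp.{u}.IsMultiplicative :=
  inferInstanceAs (MorphismProperty.IsMultiplicative (@Etale.{u} : MorphismProperty Scheme.{u}))

instance : etaleProp.{u}.IsStableUnderBaseChange :=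
  inferInstanceAs
    (MorphismProperty.IsStableUnderBaseChange (@Etale.{u} : MorphismProperty Scheme.{u}))

instance : fppfProp.{u}.IsMultiplicative where
  id_mem X := ⟨inferInstance, inferInstance⟩
  comp_mem f g := by
    rintro ⟨_, _⟩ ⟨_, _⟩
    exact ⟨inferInstance, inferInstance⟩

instance : fppfProp.{u}.IsStableUnderBaseChange where
  of_isPullback h hf :=
    ⟨MorphismProperty.of_isPullback (P := (@Flat.{u} : MorphismProperty Scheme.{u})) h hf.1,
      MorphismProperty.of_isPullback
        (P := (@LocallyOfFinitePresentation.{u} : MorphismProperty Scheme.{u})) h hf.2⟩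

/-- A small family `{Xᵢ ⟶ U}` of morphisms with the property `P` is a covering if it is jointly
surjective. -/
def IsPropCovering (P : MorphismProperty Scheme.{u}) {U : Scheme.{u}} {ι : Type u}
    {X : ι → Scheme.{u}} (f : ∀ i, X i ⟶ U) : Prop :=
  (∀ i, P (f i)) ∧ ∀ x : U, ∃ i, x ∈ Set.range (f i)

section Facts

variable {U : Scheme.{u}} {ι : Type u} {X : ι → Scheme.{u}}

lemma isFpqcCovering_iff (f : ∀ i, X i ⟶ U) :
    IsFpqcCovering f ↔ IsPropCovering flatProp f ∧
      QuasiCompactCover ({ I₀ := ι, X := X, f := f } : PreZeroHypercover.{u} U) := by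
  have hdesc (p : Σ i, X i) : Sigma.desc f (sigmaMk X p) = f p.1 p.2 := by
    obtain ⟨i, x⟩ := p
    rw [sigmaMk_mk, ← Scheme.Hom.comp_apply, Sigma.ι_desc]
  have hcov (W : Set U) : IsCompactOpenCovered (fun i ↦ (f i : X i → U)) W ↔
      ∃ V : (∐ X :).Opens, IsCompact (V : Set (∐ X :)) ∧ Sigma.desc f '' (V : Set (∐ X :)) = W := by
    rw [IsCompactOpenCovered.iff_isCompactOpenCovered_sigmaMk, IsCompactOpenCovered.iff_of_unique]
    constructor
    · rintro ⟨V, hV, h⟩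
      refine ⟨⟨sigmaMk X '' V, (sigmaMk X).isOpenMap _ V.2⟩, hV.image (sigmaMk X).continuous, ?_⟩
      rw [← h]
      simp only [TopologicalSpace.Opens.coe_mk, Set.image_image, hdesc]
      rfl
    · rintro ⟨V, hV, h⟩
      refine ⟨⟨sigmaMk X ⁻¹' V, V.2.preimage (sigmaMk X).continuous⟩,
        (sigmaMk X).isCompact_preimage.mpr hV, ?_⟩
      have hV' := Set.image_preimage_eq (V : Set (∐ X :)) (sigmaMk X).surjective
      rw [← h, ← congrArg (Set.image (Sigma.desc f)) hV', Set.image_image]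
      simp only [hdesc]
  constructor
  · rintro ⟨h₁, h₂, h₃⟩
    refine ⟨⟨fun i ↦ ?_, fun x ↦ ?_⟩, ⟨fun {W} hW ↦ (hcov W).mpr (h₃ W hW.isCompact)⟩⟩
    · have : f i = Sigma.ι X i ≫ Sigma.desc f := by simp
      rw [this]
      exact inferInstanceAs (Flat (Sigma.ι X i ≫ Sigma.desc f))
    · obtain ⟨y, rfl⟩ := h₂.surj x
      obtain ⟨⟨i, z⟩, rfl⟩ := (sigmaMk X).surjective y
      exact ⟨i, z, (hdesc ⟨i, z⟩).symm⟩
  · rintro ⟨⟨h₁, h₂⟩, h₃⟩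
    refine ⟨@IsZariskiLocalAtSource.sigmaDesc @Flat
      HasRingHomProperty.instIsZariskiLocalAtSource _ _ _ _ _ h₁, ⟨fun x ↦ ?_⟩, fun W hW ↦ (hcov W).mp
      (QuasiCompactCover.isCompactOpenCovered_of_isCompact
        { I₀ := ι, X := X, f := f } hW)⟩
    obtain ⟨i, y, rfl⟩ := h₂ x
    exact ⟨sigmaMk X ⟨i, y⟩, hdesc _⟩

lemma IsPropCovering.of_isIso (P : MorphismProperty Scheme.{u}) [P.ContainsIdentities]
    [P.RespectsIso] {V : Scheme.{u}} (f : V ⟶ U) [IsIso f] :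
    IsPropCovering P (fun _ : PUnit.{u + 1} ↦ f) :=
  ⟨fun _ ↦ P.of_isIso f, fun x ↦ ⟨⟨⟩, f.surjective x⟩⟩

lemma IsPropCovering.of_isPullback {P : MorphismProperty Scheme.{u}} [P.IsStableUnderBaseChange]
    {V : Scheme.{u}} {g : V ⟶ U} {f : ∀ i, X i ⟶ U} {Y : ι → Scheme.{u}} {f' : ∀ i, Y i ⟶ V}
    {p : ∀ i, Y i ⟶ X i} (h : ∀ i, IsPullback (p i) (f' i) (f i) g) (hf : IsPropCovering P f) :
    IsPropCovering P f' := by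
  refine ⟨fun i ↦ P.of_isPullback (h i) (hf.1 i), fun x ↦ ?_⟩
  obtain ⟨i, y, hy⟩ := hf.2 (g x)
  obtain ⟨z, -, hz⟩ := Scheme.Pullback.exists_preimage_pullback y x hy
  refine ⟨i, (h i).isoPullback.inv z, ?_⟩
  rw [← Scheme.Hom.comp_apply, (h i).isoPullback_inv_snd, hz]

lemma IsPropCovering.comp {P : MorphismProperty Scheme.{u}} [P.IsStableUnderComposition]
    {f : ∀ i, X i ⟶ U} {κ : ι → Type u} {Y : ∀ i, κ i → Scheme.{u}} {h : ∀ i k, Y i k ⟶ X i}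
    (hf : IsPropCovering P f) (hh : ∀ i, IsPropCovering P (h i)) :
    IsPropCovering P (fun p : Σ i, κ i ↦ h p.1 p.2 ≫ f p.1) := by
  refine ⟨fun p ↦ P.comp_mem _ _ ((hh p.1).1 p.2) (hf.1 p.1), fun x ↦ ?_⟩
  obtain ⟨i, y, rfl⟩ := hf.2 x
  obtain ⟨k, z, rfl⟩ := (hh i).2 y
  exact ⟨⟨i, k⟩, z, Scheme.Hom.comp_apply _ _ _⟩

lemma IsFpqcCovering.of_isIso {V : Scheme.{u}} (f : V ⟶ U) [IsIso f] :
    IsFpqcCovering (fun _ : PUnit.{u + 1} ↦ f) := by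
  rw [isFpqcCovering_iff]
  exact ⟨.of_isIso _ f, inferInstanceAs (QuasiCompactCover (.singleton f))⟩

lemma IsFpqcCovering.of_isPullback
    {V : Scheme.{u}} {g : V ⟶ U} {f : ∀ i, X i ⟶ U} {Y : ι → Scheme.{u}} {f' : ∀ i, Y i ⟶ V}
    {p : ∀ i, Y i ⟶ X i} (h : ∀ i, IsPullback (p i) (f' i) (f i) g) (hf : IsFpqcCovering f) :
    IsFpqcCovering f' := by
  rw [isFpqcCovering_iff] at hf ⊢
  obtain ⟨h₁, h₂⟩ := hf
  refine ⟨h₁.of_isPullback h, ?_⟩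
  let E : PreZeroHypercover.{u} U := { I₀ := ι, X := X, f := f }
  exact .of_hom (𝒱 := E.pullback₂ g)
    { s₀ := id, h₀ := fun i ↦ (h i).isoPullback.inv, w₀ := fun i ↦ (h i).isoPullback_inv_snd }

lemma IsFpqcCovering.comp
    {f : ∀ i, X i ⟶ U} {κ : ι → Type u} {Y : ∀ i, κ i → Scheme.{u}} {h : ∀ i k, Y i k ⟶ X i}
    (hf : IsFpqcCovering f) (hh : ∀ i, IsFpqcCovering (h i)) :
    IsFpqcCovering (fun p : Σ i, κ i ↦ h p.1 p.2 ≫ f p.1) := by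
  rw [isFpqcCovering_iff] at hf ⊢
  obtain ⟨h₁, h₂⟩ := hf
  have h₃ i := (isFpqcCovering_iff _).mp (hh i)
  refine ⟨h₁.comp fun i ↦ (h₃ i).1, ?_⟩
  let E : PreZeroHypercover.{u} U := { I₀ := ι, X := X, f := f }
  let F (i : E.I₀) : PreZeroHypercover.{u} (E.X i) := { I₀ := κ i, X := Y i, f := h i }
  have : QuasiCompactCover E := h₂
  have (i : E.I₀) : QuasiCompactCover (F i) := (h₃ i).2
  exact inferInstanceAs (QuasiCompactCover (E.bind F))

end Facts

/-- Given a class `Cov` of small families of morphisms of schemes with a common target that contains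
the isomorphisms and is stable under base change and composition, the pretopology on `Sch/S` in
which the coverings are the families of `S`-morphisms whose underlying family of morphisms of
schemes is in `Cov`. -/
def familyPretopology (S : Scheme.{u})
    (Cov : ∀ {U : Scheme.{u}} {ι : Type u} {X : ι → Scheme.{u}}, (∀ i, X i ⟶ U) → Prop)
    (of_isIso : ∀ {U V : Scheme.{u}} (f : V ⟶ U) [IsIso f], Cov (fun _ : PUnit.{u + 1} ↦ f))
    (of_isPullback : ∀ {U V : Scheme.{u}} {g : V ⟶ U} {ι : Type u} {X Y : ι → Scheme.{u}}
      {f : ∀ i, X i ⟶ U} {f' : ∀ i, Y i ⟶ V} {p : ∀ i, Y i ⟶ X i},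
      (∀ i, IsPullback (p i) (f' i) (f i) g) → Cov f → Cov f')
    (comp : ∀ {U : Scheme.{u}} {ι : Type u} {X : ι → Scheme.{u}} {f : ∀ i, X i ⟶ U}
      {κ : ι → Type u} {Y : ∀ i, κ i → Scheme.{u}} {h : ∀ i k, Y i k ⟶ X i},
      Cov f → (∀ i, Cov (h i)) → Cov (fun p : Σ i, κ i ↦ h p.1 p.2 ≫ f p.1)) :
    Pretopology (Over S) where
  coverings U := {R | ∃ (ι : Type u) (X : ι → Over S) (f : ∀ i, X i ⟶ U),
    R = Presieve.ofArrows X f ∧ Cov (fun i ↦ (f i).left)}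
  has_isos U V f _ :=
    ⟨PUnit, fun _ ↦ V, fun _ ↦ f, (Presieve.ofArrows_pUnit f).symm, 
      have : IsIso f.left := inferInstanceAs (IsIso ((Over.forget S).map f))
      of_isIso f.left⟩
  pullbacks U V g R := by
    rintro ⟨ι, X, f, rfl, hf⟩
    exact ⟨ι, _, _, (Presieve.ofArrows_pullback g X f).symm,
      of_isPullback (fun i ↦ (IsPullback.of_hasPullback (f i) g).map (Over.forget S)) hf⟩
  transitive U R T := by
    rintro ⟨ι, X, f, rfl, hf⟩ hT
    choose κ Y h hR hh using fun i ↦ hT (f i) ⟨i⟩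
    refine ⟨Σ i, κ i, fun p ↦ Y p.1 p.2, fun p ↦ h p.1 p.2 ≫ f p.1, ?_, comp hf hh⟩
    funext Z
    ext g
    constructor
    · rintro ⟨W, a, b, ⟨i⟩, ha, rfl⟩
      rw [hR] at ha
      obtain ⟨k⟩ := ha
      exact Presieve.ofArrows.mk (⟨i, k⟩ : Σ i, κ i)
    · rintro ⟨i, k⟩
      refine ⟨_, h i k, f i, ⟨i⟩, ?_, rfl⟩
      rw [hR]
      exact ⟨k⟩

/-- The fpqc topology on `Sch/S`: coverings are the families `{Uᵢ ⟶ U}` such that the induced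
morphism `∐ Uᵢ ⟶ U` is fpqc. -/
def fpqcPretopology (S : Scheme.{u}) : Pretopology (Over S) :=
  familyPretopology S IsFpqcCovering .of_isIso .of_isPullback .comp

/-- The fppf topology on `Sch/S`: coverings are the jointly surjective families of flat morphisms
locally of finite presentation. -/
def fppfPretopology (S : Scheme.{u}) : Pretopology (Over S) :=
  familyPretopology S (IsPropCovering fppfProp)
    (.of_isIso _) .of_isPullback .comp

/-- The (global) étale topology on `Sch/S`: coverings are the jointly surjective families of étale
morphisms (étale morphisms are locally of finite presentation). -/
def etalePretopology (S : Scheme.{u}) : Pretopology (Over S) :=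
  familyPretopology S (IsPropCovering etaleProp) (.of_isIso _) .of_isPullback .comp

end FpqcDescent

namespace FpqcDescent

/-! The core is faithfully flat descent: for a faithfully flat ring map `A → B`, `A` is the
equalizer of `B ⇉ B ⊗[A] B`. With Zariski gluing this makes `Hom(-, X)` an fpqc sheaf; it enters as
subcanonicity of `Scheme.fpqcTopology` and `Scheme.fppfTopology`. Subcanonicity passes from `J` to
`J.over S` and to any coarser topology, so it suffices to compare the pretopologies on `Sch/S` with
these localizations (`familyPretopology_toGrothendieck_le_over`). An fpqc morphism is a one-element
covering, and the sheaf condition for it is effective epimorphy. -/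

/-- If every family in `Cov` generates a covering sieve for the Grothendieck topology `J` on schemes,
the topology of the associated pretopology on `Sch/S` is coarser than the localization of `J`
at `S`. -/
lemma familyPretopology_toGrothendieck_le_over (S : Scheme.{u})
    (J : GrothendieckTopology Scheme.{u})
    (Cov : ∀ {U : Scheme.{u}} {ι : Type u} {X : ι → Scheme.{u}}, (∀ i, X i ⟶ U) → Prop)
    (of_isIso : ∀ {U V : Scheme.{u}} (f : V ⟶ U) [IsIso f], Cov (fun _ : PUnit.{u + 1} ↦ f))
    (of_isPullback : ∀ {U V : Scheme.{u}} {g : V ⟶ U} {ι : Type u} {X Y : ι → Scheme.{u}}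
      {f : ∀ i, X i ⟶ U} {f' : ∀ i, Y i ⟶ V} {p : ∀ i, Y i ⟶ X i},
      (∀ i, IsPullback (p i) (f' i) (f i) g) → Cov f → Cov f')
    (comp : ∀ {U : Scheme.{u}} {ι : Type u} {X : ι → Scheme.{u}} {f : ∀ i, X i ⟶ U}
      {κ : ι → Type u} {Y : ∀ i, κ i → Scheme.{u}} {h : ∀ i k, Y i k ⟶ X i},
      Cov f → (∀ i, Cov (h i)) → Cov (fun p : Σ i, κ i ↦ h p.1 p.2 ≫ f p.1))
    (hJ : ∀ {U : Scheme.{u}} {ι : Type u} {X : ι → Scheme.{u}} (f : ∀ i, X i ⟶ U),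
      Cov f → Sieve.ofArrows X f ∈ J U) :
    (familyPretopology S Cov of_isIso of_isPullback comp).toGrothendieck ≤ J.over S := by
  rintro U T ⟨R, ⟨ι, X, f, rfl, hf⟩, hR⟩
  refine (J.over S).superset_covering ((Sieve.generate_le_iff _ _).mpr hR) ?_
  -- Covering in `J.over S` is tested on the corresponding sieve of the underlying scheme, which the
  -- underlying arrows generate.
  rw [J.mem_over_iff]
  change Sieve.overEquiv U (Sieve.ofArrows X f) ∈ _
  rw [Sieve.overEquiv_ofArrows]
  exact hJ _ hf

section Coverings

variable {U : Scheme.{u}} {ι : Type u} {X : ι → Scheme.{u}}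

lemma IsPropCovering.ofArrows_mem_precoverage {P : MorphismProperty Scheme.{u}} {f : ∀ i, X i ⟶ U}
    (hf : IsPropCovering P f) : Presieve.ofArrows X f ∈ Scheme.precoverage P U :=
  (Scheme.presieve₀_mem_precoverage_iff
    (E := ({ I₀ := ι, X := X, f := f } : PreZeroHypercover.{u} U))).mpr ⟨hf.2, hf.1⟩

/-- The two halves of `isFpqcCovering_iff` match the two precoverages whose intersection generates
`Scheme.fpqcTopology`. -/
lemma IsFpqcCovering.ofArrows_mem_fpqcTopology {f : ∀ i, X i ⟶ U} (hf : IsFpqcCovering f) :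
    Sieve.ofArrows X f ∈ Scheme.fpqcTopology U := by
  rw [isFpqcCovering_iff] at hf
  exact Precoverage.generate_mem_toGrothendieck
    ⟨Scheme.presieve₀_mem_qcPrecoverage_iff.mpr hf.2, hf.1.ofArrows_mem_precoverage⟩

lemma IsPropCovering.ofArrows_mem_fppfTopology {f : ∀ i, X i ⟶ U}
    (hf : IsPropCovering fppfProp f) : Sieve.ofArrows X f ∈ Scheme.fppfTopology U :=
  Precoverage.generate_mem_toGrothendieck hf.ofArrows_mem_precoverage

lemma IsPropCovering.fppf_of_etale {f : ∀ i, X i ⟶ U}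
    (hf : IsPropCovering etaleProp f) : IsPropCovering fppfProp f :=
  ⟨fun i ↦ have : Etale (f i) := hf.1 i; ⟨inferInstance, inferInstance⟩, hf.2⟩

lemma IsFpqc.isFpqcCovering {V : Scheme.{u}} {f : V ⟶ U} (hf : IsFpqc f) :
    IsFpqcCovering (fun _ : PUnit.{u + 1} ↦ f) := by
  rw [isFpqcCovering_iff]
  refine ⟨⟨fun _ ↦ hf.flat, fun x ↦ ⟨⟨⟩, hf.surjective.surj x⟩⟩, ⟨fun {W} hW ↦ ?_⟩⟩
  -- For a single arrow, being covered by compact opens means being the image of one compact open.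
  exact (IsCompactOpenCovered.iff_of_unique (ι := PUnit.{u + 1})).mpr
    (hf.exists_isCompact W hW.isCompact)

end Coverings

instance subcanonical_fpqcPretopology (S : Scheme.{u}) :
    (fpqcPretopology S).toGrothendieck.Subcanonical :=
  .of_le (familyPretopology_toGrothendieck_le_over S Scheme.fpqcTopology _
    .of_isIso .of_isPullback .comp
    fun _ hf ↦ hf.ofArrows_mem_fpqcTopology)

instance subcanonical_fppfPretopology (S : Scheme.{u}) :
    (fppfPretopology S).toGrothendieck.Subcanonical :=
  .of_le (familyPretopology_toGrothendieck_le_over S Scheme.fppfTopology _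
    (.of_isIso _) .of_isPullback .comp
    fun _ hf ↦ hf.ofArrows_mem_fppfTopology)

instance subcanonical_etalePretopology (S : Scheme.{u}) :
    (etalePretopology S).toGrothendieck.Subcanonical :=
  .of_le (familyPretopology_toGrothendieck_le_over S Scheme.fppfTopology _
    (.of_isIso _) .of_isPullback .comp
    fun _ hf ↦ hf.fppf_of_etale.ofArrows_mem_fppfTopology)

lemma IsFpqc.isSheafFor_singleton {S : Scheme.{u}} {V U : Over S} {f : V ⟶ U}
    (hf : IsFpqc f.left) (X : Over S) :
    Presieve.IsSheafFor (yoneda.obj X) (Presieve.singleton f) := by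
  -- The sheaf property speaks of covering sieves, hence the passage to the generated sieve.
  rw [Presieve.isSheafFor_iff_generate]
  refine GrothendieckTopology.Subcanonical.isSheaf_of_isRepresentable
    (J := (fpqcPretopology S).toGrothendieck) (yoneda.obj X) _
    ⟨Presieve.singleton f, ⟨PUnit, fun _ ↦ V, fun _ ↦ f, ?_, hf.isFpqcCovering⟩,
      Sieve.le_generate _⟩
  exact (Presieve.ofArrows_pUnit f).symm

/-- An fpqc morphism of `S`-schemes is an effective epimorphism in `Sch/S`. -/
lemma IsFpqc.effectiveEpi {S : Scheme.{u}} {V U : Over S} {f : V ⟶ U} (hf : IsFpqc f.left) :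
    EffectiveEpi f := by
  rw [← Sieve.effectiveEpimorphic_singleton,
    Presieve.EffectiveEpimorphic.iff_forall_isSheafFor_yoneda]
  exact hf.isSheafFor_singleton

/-- Any pair `p₁`, `p₂` with `p₁ ≫ f = p₂ ≫ f` factors through `V ×_U V`, so compatibility of `b`
need only be known on the two projections. -/
lemma IsFpqc.existsUnique_comp_eq {S : Scheme.{u}} {V U : Over S} {f : V ⟶ U}
    (hf : IsFpqc f.left) {X : Over S} (b : V ⟶ X)
    (hb : pullback.fst f f ≫ b = pullback.snd f f ≫ b) : ∃! a : U ⟶ X, f ≫ a = b := by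
  refine Presieve.isSheafFor_singleton.mp (hf.isSheafFor_singleton X) b fun p₁ p₂ h ↦ ?_
  change p₁ ≫ b = p₂ ≫ b
  rw [← pullback.lift_fst p₁ p₂ h, Category.assoc, hb, pullback.lift_snd_assoc]

end FpqcDescent

theorem theorem2p55 (S : Scheme.{u}) :
    (∀ F : (Over S)ᵒᵖ ⥤ Type u, F.IsRepresentable →
      Presieve.IsSheaf (FpqcDescent.fpqcPretopology S).toGrothendieck F) ∧
    (∀ {V U : Over S} (f : V ⟶ U), FpqcDescent.IsFpqc f.left →
      EffectiveEpi f ∧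
      ∀ (X : Over S) (b : V ⟶ X), pullback.fst f f ≫ b = pullback.snd f f ≫ b →
        ∃! a : U ⟶ X, f ≫ a = b) ∧
    (FpqcDescent.fpqcPretopology S).toGrothendieck.Subcanonical ∧
    (FpqcDescent.etalePretopology S).toGrothendieck.Subcanonical ∧
    (FpqcDescent.fppfPretopology S).toGrothendieck.Subcanonical :=
  ⟨fun F _ ↦ GrothendieckTopology.Subcanonical.isSheaf_of_isRepresentable F,
    fun _ hf ↦ ⟨hf.effectiveEpi, fun _ b hb ↦ hf.existsUnique_comp_eq b hb⟩,
    inferInstance, inferInstance, inferInstance⟩
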